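/- Let $S$ be a (Hausdorff) complex surface, for example a compact one. A holomorphic foliation $\mathcal F$ on $S$ is given by an open cover $\{U_i\}$ of $S$, holomorphic vector fields $X_i$ on $U_i$ with isolated zeros, and invertible holomorphic functions $g_{ij}$ on $U_i\cap U_j$ with $X_i=g_{ij}X_j$. Its tangent bundle $T\mathcal F$ is the holomorphic line bundle with local frames $X_i$, and its canonical bundle is the dual $K_{\mathcal F}=T^*\mathcal F$; thus a section of $K_{\mathcal F}$ is a family of holomorphic functions $s_i$ on $U_i$ with $s_i=g_{ij}s_j$. The foliation is reduced if, at every singular point $p$ and for every vector field $X$ generating $\mathcal F$ near $p$, the eigenvalues of the linear part of $X$ at $p$ are not both zero and their quotient, when defined, is not a positive rational number. Let $\mathcal F$ be a reduced holomorphic foliation on $S$ and let $C\subset S$ be a compact smooth holomorphic curve (an embedded compact Riemann surface, not necessarily connected) that is invariant by $\mathcal F$, i.e. every $X_i$ is tangent to $C$ at the points of $C\cap U_i$. For $p\in C$ let $Z(\mathcal F,C,p)\ge 0$ be the vanishing order at $p$ of the restriction $X|_C$ of a vector field $X$ generating $\mathcal F$ near $p$: in a local coordinate $z$ of $C$ centred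 at $p$ one has $X|_C=(c\,z^{k}+\text{higher order terms})\,\partial/\partial z$ with $c\neq 0$ and $k=Z(\mathcal F,C,p)$. This is zero for all but finitely many $p\in C$; put $Z(\mathcal F,C)=\sum_{p\in C}Z(\mathcal F,C,p)$. Then: 1. There is an isomorphism of holomorphic line bundles on $C$ $$(K_{\mathcal F})|_C\;\cong\;\Omega^1_C\otimes\mathcal O_C\Big(\sum_{p\in C}Z(\mathcal F,C,p)\cdot p\Big).$$ 2. For every integer $m\ge 0$, $$h^0\big(C,(K_{\mathcal F})|_C^{\otimes m}\big)\;\le\; h^0\big(C,(\Omega^1_C)^{\otimes m}\big)+m\cdot Z(\mathcal F,C),$$ where $h^0$ denotes the dimension of the space of global holomorphic sections. -/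

import Mathlib

open scoped Manifold ContDiff Topology
open TopologicalSpace

noncomputable section

namespace FoliatedSurface

/-! ### Holomorphic line bundles, given by cocycles -/

/-- A holomorphic line bundle on a complex manifold `M` (modelled on `E`), given by an open cover
`baseSet i` and holomorphic transition functions `g i j` satisfying the cocycle identities.
Convention: a section is a family of functions `s i` on `baseSet i` with `s i = g i j * s j` on
overlaps.  Values of `g i j` off `baseSet i ∩ baseSet j` are irrelevant. -/
structure LineBundle (E : Type*) [NormedAddCommGroup E] [NormedSpace ℂ E]
    (M : Type*) [TopologicalSpace M] [ChartedSpace E M] (ι : Type*) where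
  baseSet : ι → Opens M
  exists_mem : ∀ x, ∃ i, x ∈ baseSet i
  g : ι → ι → M → ℂ
  holomorphic : ∀ i j, ContMDiffOn 𝓘(ℂ, E) 𝓘(ℂ) ω (g i j) (baseSet i ∩ baseSet j)
  g_self : ∀ i, ∀ x ∈ baseSet i, g i i x = 1
  g_comp : ∀ i j k, ∀ x, x ∈ baseSet i → x ∈ baseSet j → x ∈ baseSet k →
    g i j x * g j k x = g i k x

namespace LineBundle

variable {E : Type*} [NormedAddCommGroup E] [NormedSpace ℂ E]
  {M : Type*} [TopologicalSpace M] [ChartedSpace E M] {ι κ : Type*}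

theorem g_ne_zero (L : LineBundle E M ι) {i j : ι} {x : M} (hi : x ∈ L.baseSet i)
    (hj : x ∈ L.baseSet j) : L.g i j x ≠ 0 := by
  intro h
  have := L.g_comp i j i x hi hj hi
  rw [h, L.g_self i x hi, zero_mul] at this
  exact zero_ne_one this

/-- Isomorphism of line bundles given by cocycles, possibly on different covers: nowhere vanishing
holomorphic functions `φ a i` on the intersections of the two covers which send sections to
sections by `t a = φ a i * s i`. -/
structure Iso (L : LineBundle E M ι) (L' : LineBundle E M κ) where
  φ : κ → ι → M → ℂ
  holomorphic : ∀ a i, ContMDiffOn 𝓘(ℂ, E) 𝓘(ℂ) ω (φ a i) (L'.baseSet a ∩ L.baseSet i)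
  ne_zero : ∀ a i, ∀ x, x ∈ L'.baseSet a → x ∈ L.baseSet i → φ a i x ≠ 0
  compat : ∀ a b i j, ∀ x, x ∈ L'.baseSet a → x ∈ L'.baseSet b → x ∈ L.baseSet i →
    x ∈ L.baseSet j → φ a i x * L.g i j x = L'.g a b x * φ b j x

/-- The space of global holomorphic sections.  The functions `s i` matter only on `baseSet i`; they
are normalised to be zero elsewhere. -/
def sections (L : LineBundle E M ι) : Submodule ℂ (ι → M → ℂ) where
  carrier := {s | (∀ i, ContMDiffOn 𝓘(ℂ, E) 𝓘(ℂ) ω (s i) (L.baseSet i)) ∧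
    (∀ i, ∀ x ∉ L.baseSet i, s i x = 0) ∧
    ∀ i j x, x ∈ L.baseSet i → x ∈ L.baseSet j → s i x = L.g i j x * s j x}
  add_mem' := by
    rintro s t ⟨h1, h2, h3⟩ ⟨h1', h2', h3'⟩
    refine ⟨fun i => (h1 i).add (h1' i), fun i x hx => ?_, fun i j x hi hj => ?_⟩
    · simp [h2 i x hx, h2' i x hx]
    · simp [h3 i j x hi hj, h3' i j x hi hj, mul_add]
  zero_mem' := ⟨fun _ => contMDiffOn_const, fun _ _ _ => rfl, fun _ _ _ _ _ => by simp⟩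
  smul_mem' := by
    rintro c s ⟨h1, h2, h3⟩
    refine ⟨fun i => (contMDiffOn_const (I := 𝓘(ℂ, E)) (I' := 𝓘(ℂ)) (M := M) (c := c)).smul (h1 i), fun i x hx => ?_, fun i j x hi hj => ?_⟩
    · simp [h2 i x hx]
    · simp [h3 i j x hi hj, mul_left_comm]

/-- `h⁰(M, L)`, the dimension of the space of global sections (`⊤` if it is infinite). -/
def h0 (L : LineBundle E M ι) : ℕ∞ := Cardinal.toENat (Module.rank ℂ L.sections)

/-- The tensor product `L ⊗ L'`. -/
def tensor (L : LineBundle E M ι) (L' : LineBundle E M κ) : LineBundle E M (ι × κ) where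
  baseSet a := L.baseSet a.1 ⊓ L'.baseSet a.2
  exists_mem x := by
    obtain ⟨i, hi⟩ := L.exists_mem x
    obtain ⟨j, hj⟩ := L'.exists_mem x
    exact ⟨(i, j), hi, hj⟩
  g a b x := L.g a.1 b.1 x * L'.g a.2 b.2 x
  holomorphic a b := by
    refine ContMDiffOn.mul ((L.holomorphic a.1 b.1).mono ?_) ((L'.holomorphic a.2 b.2).mono ?_)
    · exact fun _ hx => ⟨hx.1.1, hx.2.1⟩
    · exact fun _ hx => ⟨hx.1.2, hx.2.2⟩
  g_self a x hx := by rw [L.g_self _ x hx.1, L'.g_self _ x hx.2, one_mul]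
  g_comp a b c x ha hb hc := by
    rw [← L.g_comp _ _ _ x ha.1 hb.1 hc.1, ← L'.g_comp _ _ _ x ha.2 hb.2 hc.2]; ring

/-- The tensor power `L^{⊗ m}`. -/
def tensorPow (L : LineBundle E M ι) (m : ℕ) : LineBundle E M ι where
  baseSet := L.baseSet
  exists_mem := L.exists_mem
  g i j x := L.g i j x ^ m
  holomorphic i j := (L.holomorphic i j).pow m
  g_self i x hx := by rw [L.g_self i x hx, one_pow]
  g_comp i j k x hi hj hk := by rw [← mul_pow, L.g_comp i j k x hi hj hk]

/-- The dual line bundle. -/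
def dual (L : LineBundle E M ι) : LineBundle E M ι where
  baseSet := L.baseSet
  exists_mem := L.exists_mem
  g i j x := (L.g i j x)⁻¹
  holomorphic i j := (L.holomorphic i j).inv₀ fun _ hx => L.g_ne_zero hx.1 hx.2
  g_self i x hx := by rw [L.g_self i x hx, inv_one]
  g_comp i j k x hi hj hk := by rw [← mul_inv, L.g_comp i j k x hi hj hk]

/-- The pull-back of `L` along a holomorphic map `f`; when `f` is the inclusion of a submanifold
this is the restriction of `L`. -/
def pullback {E' : Type*} [NormedAddCommGroup E'] [NormedSpace ℂ E']
    {M' : Type*} [TopologicalSpace M'] [ChartedSpace E' M'] (L : LineBundle E M ι) (f : M' → M)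
    (hf : ContMDiff 𝓘(ℂ, E') 𝓘(ℂ, E) ω f) : LineBundle E' M' ι where
  baseSet i := ⟨f ⁻¹' L.baseSet i, (L.baseSet i).isOpen.preimage hf.continuous⟩
  exists_mem x := L.exists_mem (f x)
  g i j x := L.g i j (f x)
  holomorphic i j := (L.holomorphic i j).comp hf.contMDiffOn fun _ hx => hx
  g_self i _ hx := L.g_self i _ hx
  g_comp i j k _ hi hj hk := L.g_comp i j k _ hi hj hk

end LineBundle

/-! ### Line bundles on a Riemann surface -/

section RiemannSurface

variable (C : Type*) [TopologicalSpace C] [ChartedSpace ℂ C]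

/-- The holomorphic tangent bundle `TC` of a Riemann surface: the cocycle of Mathlib's tangent
bundle, whose `coordChange j i x` passes from the coordinate in the chart `j` to the coordinate in
the chart `i`. -/
def tangentLineBundle [IsManifold 𝓘(ℂ) ω C] : LineBundle ℂ C (atlas ℂ C) where
  baseSet i := ⟨i.1.source, i.1.open_source⟩
  exists_mem x := ⟨achart ℂ x, mem_chart_source ℂ x⟩
  g i j x := (tangentBundleCore 𝓘(ℂ) C).coordChange j i x 1
  holomorphic i j := by
    have h1 : IsManifold 𝓘(ℂ) (ω + 1) C := inferInstanceAs (IsManifold 𝓘(ℂ) ω C)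
    have h2 : (tangentBundleCore 𝓘(ℂ) C).IsContMDiff 𝓘(ℂ) ω := tangentBundleCore.isContMDiff
    have := (tangentBundleCore 𝓘(ℂ) C).contMDiffOn_coordChange (n := ω) 𝓘(ℂ) j i
    exact (this.mono fun x hx => ⟨hx.2, hx.1⟩).clm_apply contMDiffOn_const
  g_self i x hx := (tangentBundleCore 𝓘(ℂ) C).coordChange_self i x hx 1
  g_comp i j k x hi hj hk := by
    have := (tangentBundleCore 𝓘(ℂ) C).coordChange_comp k j i x ⟨⟨hk, hj⟩, hi⟩ 1
    have h := ((tangentBundleCore 𝓘(ℂ) C).coordChange j i x).map_smul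
      ((tangentBundleCore 𝓘(ℂ) C).coordChange k j x 1) 1
    rw [← this, mul_comm, ← smul_eq_mul, ← h, smul_eq_mul, mul_one]

/-- The bundle `Ω¹_C` of holomorphic `1`-forms. -/
def cotangentLineBundle [IsManifold 𝓘(ℂ) ω C] : LineBundle ℂ C (atlas ℂ C) :=
  (tangentLineBundle C).dual

variable {C}

/-- The local equation `(z - z(p)) ^ D(p)` of the divisor `D` near `p`, where `z` is the preferred
chart at `p`. -/
def localEquation (D : Function.locallyFinsupp C ℤ) (p x : C) : ℂ :=
  (chartAt ℂ p x - chartAt ℂ p p) ^ D p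

/-- A neighbourhood of `p` on which `localEquation D p` is an equation of `D`: the chart domain at
`p`, without the points of the support of `D` other than `p`. -/
def divisorNhd [T1Space C] (D : Function.locallyFinsupp C ℤ) (p : C) : Opens C where
  carrier := (chartAt ℂ p).source \ (D.support \ {p})
  is_open' := by
    refine (chartAt ℂ p).open_source.sdiff ?_
    exact isClosed_of_subset_discrete_closed Set.sdiff_subset D.discreteSupport
      (D.closedSupport isClosed_univ)

theorem eq_zero_or_sub_ne_zero [T1Space C] (D : Function.locallyFinsupp C ℤ) {p q x : C}
    (hpq : p ≠ q) (hp : x ∈ divisorNhd D p) (hq : x ∈ divisorNhd D q) :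
    D p = 0 ∨ chartAt ℂ p x - chartAt ℂ p p ≠ 0 := by
  by_contra! h
  have hx : x = p := (chartAt ℂ p).injOn hp.1 (mem_chart_source ℂ p) (sub_eq_zero.1 h.2)
  subst hx
  exact hq.2 ⟨h.1, hpq⟩

theorem localEquation_ne_zero [T1Space C] (D : Function.locallyFinsupp C ℤ) {p q x : C}
    (hpq : p ≠ q) (hp : x ∈ divisorNhd D p) (hq : x ∈ divisorNhd D q) :
    localEquation D p x ≠ 0 := by
  rcases eq_zero_or_sub_ne_zero D hpq hp hq with h | h
  · simp [localEquation, h]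
  · exact zpow_ne_zero _ h

theorem contMDiffOn_localEquation [IsManifold 𝓘(ℂ) ω C] (D : Function.locallyFinsupp C ℤ) (p : C)
    {s : Set C} (hs : ∀ x ∈ s, x ∈ (chartAt ℂ p).source ∧
      (D p = 0 ∨ chartAt ℂ p x - chartAt ℂ p p ≠ 0)) :
    ContMDiffOn 𝓘(ℂ) 𝓘(ℂ) ω (localEquation D p) s := by
  by_cases h0 : D p = 0
  · have : localEquation D p = fun _ => 1 := by funext x; simp [localEquation, h0]
    rw [this]
    exact contMDiffOn_const
  have h1 : ContMDiffOn 𝓘(ℂ) 𝓘(ℂ) ω (fun x => chartAt ℂ p x - chartAt ℂ p p) s :=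
    ((contMDiffOn_chart (I := 𝓘(ℂ)) (x := p)).mono fun x hx => (hs x hx).1).sub contMDiffOn_const
  have h2 : ∀ x ∈ s, chartAt ℂ p x - chartAt ℂ p p ≠ 0 := fun x hx =>
    (hs x hx).2.resolve_left h0
  unfold localEquation
  rcases Int.eq_nat_or_neg (D p) with ⟨n, hn | hn⟩
  · simpa only [hn, zpow_natCast] using h1.pow n
  · simpa only [hn, zpow_neg, zpow_natCast] using (h1.pow n).inv₀ fun x hx => pow_ne_zero n (h2 x hx)

/-- The line bundle `O_C(D)`, with cocycle `g p q = f p / f q` where `f p` is the local equation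
of `D` on `divisorNhd D p`.  A meromorphic function `h` with `div h + D ≥ 0` corresponds to the
section `s p = f p * h`. -/
def divisorLineBundle [T1Space C] [IsManifold 𝓘(ℂ) ω C] (D : Function.locallyFinsupp C ℤ) :
    LineBundle ℂ C C where
  baseSet := divisorNhd D
  exists_mem x := ⟨x, mem_chart_source ℂ x, fun h => h.2 rfl⟩
  g p q x := open Classical in if p = q then 1 else localEquation D p x / localEquation D q x
  holomorphic p q := by
    by_cases hpq : p = q
    · simpa [hpq] using contMDiffOn_const
    simp only [hpq, if_false]
    refine ContMDiffOn.div₀ (contMDiffOn_localEquation D p fun x hx => ⟨hx.1.1, ?_⟩)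
      (contMDiffOn_localEquation D q fun x hx => ⟨hx.2.1, ?_⟩) fun x hx => ?_
    · exact eq_zero_or_sub_ne_zero D hpq hx.1 hx.2
    · exact eq_zero_or_sub_ne_zero D (Ne.symm hpq) hx.2 hx.1
    · exact localEquation_ne_zero D (Ne.symm hpq) hx.2 hx.1
  g_self p x _ := by simp
  g_comp p q r x hp hq hr := by
    by_cases hpq : p = q
    · subst hpq; simp
    by_cases hqr : q = r
    · subst hqr; simp
    have h1 := localEquation_ne_zero D hpq hp hq
    have h2 := localEquation_ne_zero D (Ne.symm hpq) hq hp
    by_cases hpr : p = r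
    · subst hpr
      simp [hpq, hqr]
      field_simp
    · simp only [hpq, hqr, hpr, if_false]
      field_simp

end RiemannSurface

/-! ### Vector fields -/

section VectorField

variable {E : Type*} [NormedAddCommGroup E] [NormedSpace ℂ E]
  {M : Type*} [TopologicalSpace M] [ChartedSpace E M]

/-- The expression, in the preferred chart at `p`, of a vector field. -/
def vectorFieldInChart (X : (x : M) → TangentSpace 𝓘(ℂ, E) x) (p : M) (v : E) : E :=
  mfderiv 𝓘(ℂ, E) 𝓘(ℂ, E) (extChartAt 𝓘(ℂ, E) p) ((extChartAt 𝓘(ℂ, E) p).symm v)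
    (X ((extChartAt 𝓘(ℂ, E) p).symm v))

/-- The linear part at `p` of a vector field vanishing at `p`, in the preferred chart at `p`. -/
def linearPart (X : (x : M) → TangentSpace 𝓘(ℂ, E) x) (p : M) : E →L[ℂ] E :=
  fderiv ℂ (vectorFieldInChart X p) (extChartAt 𝓘(ℂ, E) p p)

/-- The restriction to a curve `f : C → M` of a vector field `X` tangent to it: the vector field
`Y` on `C` with `df (Y) = X ∘ f`.  It is `0` at points where `X` is not tangent to the curve. -/
def restrictVectorField {C : Type*} [TopologicalSpace C] [ChartedSpace ℂ C] (f : C → M)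
    (X : (x : M) → TangentSpace 𝓘(ℂ, E) x) (q : C) : TangentSpace 𝓘(ℂ) q :=
  open Classical in
  if h : ∃ v : TangentSpace 𝓘(ℂ) q, mfderiv 𝓘(ℂ) 𝓘(ℂ, E) f q v = X (f q) then h.choose else 0

/-- The vanishing order at `p` of a vector field on a Riemann surface: the integer `k` such that
the field is `(c (z - z(p)) ^ k + h.o.t.) ∂/∂z` with `c ≠ 0` (and `0` if it vanishes near `p`). -/
def vanishingOrder {C : Type*} [TopologicalSpace C] [ChartedSpace ℂ C]
    (Y : (q : C) → TangentSpace 𝓘(ℂ) q) (p : C) : ℕ :=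
  analyticOrderNatAt (vectorFieldInChart Y p) (extChartAt 𝓘(ℂ) p p)

end VectorField

/-! ### Foliations on surfaces -/

/-- The model of a complex surface. -/
abbrev Plane : Type := EuclideanSpace ℂ (Fin 2)

/-- A holomorphic foliation on a complex surface `S`, given by an open cover, holomorphic vector
fields `X i` with isolated zeros over the members of the cover, and invertible holomorphic
functions `g i j` with `X i = g i j • X j` on overlaps. -/
structure Foliation (S : Type*) [TopologicalSpace S] [ChartedSpace Plane S]
    [IsManifold 𝓘(ℂ, Plane) ω S] (ι : Type*) where
  baseSet : ι → Opens S
  exists_mem : ∀ x, ∃ i, x ∈ baseSet i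
  X : ι → (x : S) → TangentSpace 𝓘(ℂ, Plane) x
  holomorphic_X : ∀ i, ContMDiffOn 𝓘(ℂ, Plane) 𝓘(ℂ, Plane).tangent ω
    (fun x => (⟨x, X i x⟩ : TangentBundle 𝓘(ℂ, Plane) S)) (baseSet i)
  isolated_zeros : ∀ i, ∀ p ∈ baseSet i, ∀ᶠ x in 𝓝[≠] p, X i x ≠ 0
  g : ι → ι → S → ℂ
  holomorphic_g : ∀ i j, ContMDiffOn 𝓘(ℂ, Plane) 𝓘(ℂ) ω (g i j) (baseSet i ∩ baseSet j)
  g_ne_zero : ∀ i j x, x ∈ baseSet i → x ∈ baseSet j → g i j x ≠ 0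
  X_eq : ∀ i j x, x ∈ baseSet i → x ∈ baseSet j → X i x = g i j x • X j x

theorem nhdsNE_neBot {S : Type*} [TopologicalSpace S] [ChartedSpace Plane S] (p : S) :
    (𝓝[≠] p).NeBot := by
  have h := (chartAt Plane p).continuousAt_symm (mem_chart_target Plane p)
  have hinj := (chartAt Plane p).symm.injOn
  have ht := (chartAt Plane p).open_target.mem_nhds (mem_chart_target Plane p)
  have hp := (chartAt Plane p).left_inv (mem_chart_source Plane p)
  rw [ContinuousAt, hp] at h
  refine Filter.NeBot.mono (Filter.NeBot.map
    (inferInstance : (𝓝[≠] (chartAt Plane p p)).NeBot) (chartAt Plane p).symm) ?_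
  refine tendsto_nhdsWithin_iff.2 ⟨h.mono_left nhdsWithin_le_nhds, ?_⟩
  filter_upwards [nhdsWithin_le_nhds ht, self_mem_nhdsWithin] with v hv hne heq
  exact hne (hinj hv (mem_chart_target Plane p) (heq.trans hp.symm))

namespace Foliation

variable {S : Type*} [TopologicalSpace S] [ChartedSpace Plane S] [IsManifold 𝓘(ℂ, Plane) ω S]
  {ι : Type*} (F : Foliation S ι)

theorem g_unique {i j : ι} {p : S} {u : S → ℂ} (hi : p ∈ F.baseSet i) (hj : p ∈ F.baseSet j)
    (hu : ContinuousAt u p) (h : ∀ᶠ x in 𝓝 p, F.X i x = u x • F.X j x) : F.g i j p = u p := by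
  have hne := nhdsNE_neBot p
  have hg : ContinuousAt (F.g i j) p := (F.holomorphic_g i j).continuousOn.continuousAt
    (((F.baseSet i).isOpen.inter (F.baseSet j).isOpen).mem_nhds ⟨hi, hj⟩)
  refine tendsto_nhds_unique_of_eventuallyEq (l := 𝓝[≠] p) (hg.tendsto.mono_left nhdsWithin_le_nhds)
    (hu.tendsto.mono_left nhdsWithin_le_nhds) ?_
  filter_upwards [nhdsWithin_le_nhds h, F.isolated_zeros j p hj,
    nhdsWithin_le_nhds ((F.baseSet i).isOpen.mem_nhds hi),
    nhdsWithin_le_nhds ((F.baseSet j).isOpen.mem_nhds hj)] with x h1 h2 h3 h4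
  rw [F.X_eq i j x h3 h4] at h1
  exact smul_left_injective ℂ h2 h1

/-- The canonical bundle `K_F = T^*F`: a section is a family of functions `s i`, the value of a
`1`-form along the leaves on `X i`, so that `s i = g i j * s j`. -/
def canonicalBundle : LineBundle Plane S ι where
  baseSet := F.baseSet
  exists_mem := F.exists_mem
  g := F.g
  holomorphic := F.holomorphic_g
  g_self i x hx := by
    refine F.g_unique hx hx (u := fun _ => 1) continuousAt_const ?_
    simp
  g_comp i j k x hi hj hk := by
    have hc : ∀ a b, x ∈ F.baseSet a → x ∈ F.baseSet b → ContinuousAt (F.g a b) x :=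
      fun a b ha hb => (F.holomorphic_g a b).continuousOn.continuousAt
        (((F.baseSet a).isOpen.inter (F.baseSet b).isOpen).mem_nhds ⟨ha, hb⟩)
    refine (F.g_unique hi hk (u := fun y => F.g i j y * F.g j k y)
      ((hc i j hi hj).mul (hc j k hj hk)) ?_).symm
    filter_upwards [(F.baseSet i).isOpen.mem_nhds hi, (F.baseSet j).isOpen.mem_nhds hj,
      (F.baseSet k).isOpen.mem_nhds hk] with y h1 h2 h3
    rw [F.X_eq i j y h1 h2, F.X_eq j k y h2 h3, smul_smul]

/-- The tangent bundle `TF`, of which the `X i` are the local frames; its dual is `K_F`. -/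
def tangentBundle : LineBundle Plane S ι := F.canonicalBundle.dual

/-- The vector field `Y` generates the foliation in a neighbourhood of `p`. -/
def IsGeneratorAt (Y : (x : S) → TangentSpace 𝓘(ℂ, Plane) x) (p : S) : Prop :=
  ∃ i, p ∈ F.baseSet i ∧ ∃ u : S → ℂ, ContMDiffAt 𝓘(ℂ, Plane) 𝓘(ℂ) ω u p ∧ u p ≠ 0 ∧
    ∀ᶠ x in 𝓝 p, Y x = u x • F.X i x

/-- The foliation is reduced: at every singular point `p`, for every vector field generating the
foliation near `p`, the eigenvalues `a`, `b` of the linear part are not both zero and their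
quotient, when defined, is not a positive rational number. -/
def IsReduced : Prop :=
  ∀ p Y, F.IsGeneratorAt Y p → Y p = 0 → ∀ a b : ℂ,
    (linearPart Y p).toLinearMap.charpoly.roots = {a, b} →
      (a ≠ 0 ∨ b ≠ 0) ∧ ∀ r : ℚ, 0 < r → b ≠ 0 → a / b ≠ r

variable {C : Type*} [TopologicalSpace C] [ChartedSpace ℂ C]

/-- The curve `f : C → S` is invariant by the foliation: the foliation is tangent to it. -/
def IsInvariant (f : C → S) : Prop :=
  ∀ i q, f q ∈ F.baseSet i → ∃ v : TangentSpace 𝓘(ℂ) q, mfderiv 𝓘(ℂ) 𝓘(ℂ, Plane) f q v = F.X i (f q)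

/-- `Z(F, C, p)`: the vanishing order at `p` of the restriction to the invariant curve `f : C → S`
of a vector field generating the foliation near `f p`.  (Another choice of the generator multiplies
it by a unit and does not change the order.) -/
def Z (f : C → S) (p : C) : ℕ :=
  vanishingOrder (restrictVectorField f (F.X (F.exists_mem (f p)).choose)) p

theorem X_eq_zero_of_Z_ne_zero [IsManifold 𝓘(ℂ) ω C] {f : C → S} (hC : F.IsInvariant f) {p : C}
    (h : F.Z f p ≠ 0) {i : ι} (hi : f p ∈ F.baseSet i) : F.X i (f p) = 0 := by
  have hj := (F.exists_mem (f p)).choose_spec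
  have hv := F.X_eq i _ (f p) hi hj
  have h0 := apply_eq_zero_of_analyticOrderNatAt_ne_zero h
  unfold vectorFieldInChart at h0
  rw [extChartAt_to_inv] at h0
  have hinj := (isInvertible_mfderiv_extChartAt (I := 𝓘(ℂ)) (mem_extChartAt_source p)).injective
  have h1 := hinj (h0.trans (map_zero _).symm)
  have hex := hC _ p hj
  rw [restrictVectorField, dif_pos hex] at h1
  have h2 := hex.choose_spec
  rw [h1, map_zero] at h2
  rw [hv, ← h2, smul_zero]

/-- The divisor `∑ Z(F, C, p) · p` on the invariant curve `f : C → S`. -/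
def zeroDivisor [IsManifold 𝓘(ℂ) ω C] (f : C → S)
    (hf : Manifold.IsSmoothEmbedding 𝓘(ℂ) 𝓘(ℂ, Plane) ω f) (hC : F.IsInvariant f) :
    Function.locallyFinsupp C ℤ where
  toFun p := F.Z f p
  supportWithinDomain' := Set.subset_univ _
  supportLocallyFiniteWithinDomain' := by
    intro p _
    obtain ⟨i, hi⟩ := F.exists_mem (f p)
    have h1 := eventually_nhdsWithin_iff.1 (F.isolated_zeros i (f p) hi)
    have hc := hf.isEmbedding.continuous.continuousAt (x := p)
    have h2 := hc.eventually (h1.and ((F.baseSet i).isOpen.mem_nhds hi))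
    refine ⟨_, h2, (Set.finite_singleton p).subset ?_⟩
    rintro q ⟨⟨hq1, hq2⟩, hq3⟩
    by_contra hqp
    refine hq1 (fun h => hqp (hf.isEmbedding.injective h)) ?_
    exact F.X_eq_zero_of_Z_ne_zero hC (by simpa using hq3) hq2

end Foliation

end FoliatedSurface

namespace FoliatedSurface

/-! ### Orders of vanishing and quotients of holomorphic functions on a Riemann surface -/

section Order

variable {C : Type*} [TopologicalSpace C] [ChartedSpace ℂ C]

/-! Restrict each generator `X i` to the curve and write `v i a` for its coefficient in the chart
`a` of `C` (`coordField`). On overlaps `v i a = g i j * T a b * v j b`, where `g` is the cocycle of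
the canonical bundle and `T` that of the tangent bundle of `C`. So the `v i a` form a section of
`K_F|_C ⊗ TC`. It is holomorphic (`contMDiffAt_coordField`), and its order at `p` is exactly `Z(F,
C, p)` (`orderAt_coordField`), finite because the zeros of `X i` are isolated.

A section with divisor `D = ∑ Z(F, C, p) · p` identifies `K_F|_C ⊗ TC` with `O_C(D)`, which is the
first claim. Explicitly, the isomorphism is the quotient of the local equation of `D` by `v i a`, a
unit since both have the same order everywhere.

For the second claim, multiplication by `v ^ m` sends sections of the `m`-th power of `Ω¹_C` to
sections of the `m`-th power of `K_F|_C`. By division (`exists_quotient`) every section vanishing to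
order at least `m * Z(F, C, p)` at each `p` is in the image. This vanishing amounts to `m * Z(F, C)`
linear conditions on jets, and rank-nullity gives the bound. -/

theorem nhdsNE_neBot_curve (p : C) : (𝓝[≠] p).NeBot := by
  have h := (chartAt ℂ p).continuousAt_symm (mem_chart_target ℂ p)
  have hinj := (chartAt ℂ p).symm.injOn
  have ht := (chartAt ℂ p).open_target.mem_nhds (mem_chart_target ℂ p)
  have hp := (chartAt ℂ p).left_inv (mem_chart_source ℂ p)
  rw [ContinuousAt, hp] at h
  refine Filter.NeBot.mono (Filter.NeBot.map
    (inferInstance : (𝓝[≠] (chartAt ℂ p p)).NeBot) (chartAt ℂ p).symm) ?_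
  refine tendsto_nhdsWithin_iff.2 ⟨h.mono_left nhdsWithin_le_nhds, ?_⟩
  filter_upwards [nhdsWithin_le_nhds ht, self_mem_nhdsWithin] with v hv hne heq
  exact hne (hinj hv (mem_chart_target ℂ p) (heq.trans hp.symm))

/-- Cancellation at an isolated zero `x` of `v`. -/
theorem eq_of_eventually_mul_eq {w w' v : C → ℂ} {x : C} (hw : ContinuousAt w x)
    (hw' : ContinuousAt w' x) (h : ∀ᶠ y in 𝓝 x, w y * v y = w' y * v y)
    (hv : ∀ᶠ y in 𝓝[≠] x, v y ≠ 0) : w x = w' x := by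
  have := nhdsNE_neBot_curve x
  refine tendsto_nhds_unique_of_eventuallyEq (l := 𝓝[≠] x) (hw.tendsto.mono_left nhdsWithin_le_nhds)
    (hw'.tendsto.mono_left nhdsWithin_le_nhds) ?_
  filter_upwards [nhdsWithin_le_nhds h, hv] with y h1 h2
  exact mul_right_cancel₀ h2 h1

theorem tendsto_chartAt_symm (x : C) :
    Filter.Tendsto (chartAt ℂ x).symm (𝓝 (chartAt ℂ x x)) (𝓝 x) := by
  have h := (chartAt ℂ x).continuousAt_symm (mem_chart_target ℂ x)
  rwa [ContinuousAt, (chartAt ℂ x).left_inv (mem_chart_source ℂ x)] at h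

theorem analyticAt_comp_symm_of_contMDiffAt [IsManifold 𝓘(ℂ) ω C] {u : C → ℂ} {x : C}
    (hu : ContMDiffAt 𝓘(ℂ) 𝓘(ℂ) ω u x) :
    AnalyticAt ℂ (u ∘ (chartAt ℂ x).symm) (chartAt ℂ x x) := by
  have h := (contMDiffAt_iff.1 hu).2
  have h2 : ContDiffAt ℂ ω (u ∘ (chartAt ℂ x).symm) (chartAt ℂ x x) := by
    simp only [mfld_simps, contDiffWithinAt_univ] at h
    exact h
  exact h2.analyticAt

/-- The order of vanishing of a function at a point, read in the preferred chart. -/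
def orderAt (u : C → ℂ) (x : C) : ℕ∞ :=
  analyticOrderAt (u ∘ (chartAt ℂ x).symm) (chartAt ℂ x x)

theorem orderAt_congr {u v : C → ℂ} {x : C} (h : u =ᶠ[𝓝 x] v) : orderAt u x = orderAt v x :=
  analyticOrderAt_congr ((tendsto_chartAt_symm x).eventually h)

variable [IsManifold 𝓘(ℂ) ω C]

theorem orderAt_mul {u v : C → ℂ} {x : C} (hu : ContMDiffAt 𝓘(ℂ) 𝓘(ℂ) ω u x)
    (hv : ContMDiffAt 𝓘(ℂ) 𝓘(ℂ) ω v x) :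
    orderAt (fun y => u y * v y) x = orderAt u x + orderAt v x :=
  analyticOrderAt_mul (analyticAt_comp_symm_of_contMDiffAt hu)
    (analyticAt_comp_symm_of_contMDiffAt hv)

theorem orderAt_pow {u : C → ℂ} {x : C} (hu : ContMDiffAt 𝓘(ℂ) 𝓘(ℂ) ω u x) (n : ℕ) :
    orderAt (fun y => u y ^ n) x = n • orderAt u x :=
  analyticOrderAt_pow (analyticAt_comp_symm_of_contMDiffAt hu) n

theorem orderAt_eq_zero_iff {u : C → ℂ} {x : C} (hu : ContMDiffAt 𝓘(ℂ) 𝓘(ℂ) ω u x) :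
    orderAt u x = 0 ↔ u x ≠ 0 := by
  rw [orderAt, (analyticAt_comp_symm_of_contMDiffAt hu).analyticOrderAt_eq_zero]
  simp

theorem eventually_ne_zero_of_orderAt_ne_top {u : C → ℂ} {x : C}
    (hu : ContMDiffAt 𝓘(ℂ) 𝓘(ℂ) ω u x) (h : orderAt u x ≠ ⊤) : ∀ᶠ y in 𝓝[≠] x, u y ≠ 0 := by
  have h1 := (analyticAt_comp_symm_of_contMDiffAt hu).eventually_eq_zero_or_eventually_ne_zero
  rw [← analyticOrderAt_eq_top] at h1
  have h2 := eventually_nhdsWithin_iff.1 (h1.resolve_left h)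
  have h3 := ((chartAt ℂ x).continuousAt (mem_chart_source ℂ x)).eventually h2
  refine eventually_nhdsWithin_iff.2 ?_
  filter_upwards [h3, (chartAt ℂ x).open_source.mem_nhds (mem_chart_source ℂ x)] with y hy hys hne
  have := hy fun h => hne ((chartAt ℂ x).injOn hys (mem_chart_source ℂ x) h)
  simpa [(chartAt ℂ x).left_inv hys] using this

/-- If `n` is the order of `v`, factor `v = (z - z₀) ^ n * h` with `h` nonzero at `z₀`, and `u = (z
- z₀) ^ n * g`; the quotient is `g / h`. -/
theorem exists_local_quotient {u v : C → ℂ} {x : C} (hu : ContMDiffAt 𝓘(ℂ) 𝓘(ℂ) ω u x)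
    (hv : ContMDiffAt 𝓘(ℂ) 𝓘(ℂ) ω v x) (hv' : orderAt v x ≠ ⊤) (huv : orderAt v x ≤ orderAt u x) :
    ∃ w : C → ℂ, ContMDiffAt 𝓘(ℂ) 𝓘(ℂ) ω w x ∧ ∀ᶠ y in 𝓝 x, w y * v y = u y := by
  have hu1 := analyticAt_comp_symm_of_contMDiffAt hu
  have hv1 := analyticAt_comp_symm_of_contMDiffAt hv
  obtain ⟨n, hn⟩ := ENat.ne_top_iff_exists.1 hv'
  obtain ⟨h, hh, hh0, hvh⟩ := hv1.analyticOrderAt_eq_natCast.1 hn.symm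
  rw [← hn] at huv
  obtain ⟨g, hg, hug⟩ := (natCast_le_analyticOrderAt hu1).1 huv
  have hc : ContMDiffAt 𝓘(ℂ) 𝓘(ℂ) ω (chartAt ℂ x) x := contMDiffAt_extChartAt
  have hw : AnalyticAt ℂ (fun z => g z / h z) (chartAt ℂ x x) := hg.div hh hh0
  refine ⟨fun y => g (chartAt ℂ x y) / h (chartAt ℂ x y),
    ContMDiffAt.comp (g := fun z => g z / h z) x hw.contDiffAt.contMDiffAt hc, ?_⟩
  have hcc := (chartAt ℂ x).continuousAt (mem_chart_source ℂ x)
  filter_upwards [hcc.eventually hvh, hcc.eventually hug,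
    hcc.eventually (hh.continuousAt.eventually_ne hh0),
    (chartAt ℂ x).open_source.mem_nhds (mem_chart_source ℂ x)] with y h1 h2 h3 h4
  simp only [Function.comp_apply, (chartAt ℂ x).left_inv h4, smul_eq_mul] at h1 h2
  rw [h1, h2]
  field_simp

/-- Holomorphic functions can be divided when the order of the divisor is finite and at most that
of the dividend. -/
theorem exists_quotient {W : Set C} (hW : IsOpen W) {u v : C → ℂ}
    (hu : ContMDiffOn 𝓘(ℂ) 𝓘(ℂ) ω u W) (hv : ContMDiffOn 𝓘(ℂ) 𝓘(ℂ) ω v W)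
    (hv' : ∀ x ∈ W, orderAt v x ≠ ⊤) (huv : ∀ x ∈ W, orderAt v x ≤ orderAt u x) :
    ∃ w : C → ℂ, ContMDiffOn 𝓘(ℂ) 𝓘(ℂ) ω w W ∧ ∀ x ∈ W, w x * v x = u x := by
  classical
  have hua : ∀ x ∈ W, ContMDiffAt 𝓘(ℂ) 𝓘(ℂ) ω u x := fun x hx => hu.contMDiffAt (hW.mem_nhds hx)
  have hva : ∀ x ∈ W, ContMDiffAt 𝓘(ℂ) 𝓘(ℂ) ω v x := fun x hx => hv.contMDiffAt (hW.mem_nhds hx)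
  have hloc : ∀ x : C, ∃ w : C → ℂ, x ∈ W →
      ContMDiffAt 𝓘(ℂ) 𝓘(ℂ) ω w x ∧ ∀ᶠ y in 𝓝 x, w y * v y = u y := by
    intro x
    by_cases hx : x ∈ W
    · obtain ⟨w, hw⟩ := exists_local_quotient (hua x hx) (hva x hx) (hv' x hx) (huv x hx)
      exact ⟨w, fun _ => hw⟩
    · exact ⟨0, fun h => absurd h hx⟩
  choose w hw using hloc
  -- Glue on the diagonal: each local quotient is used only at its own centre. Near `x` this agrees
  -- with `w x`, because two quotients of `u` by `v` coincide off the isolated zeros of `v`, hence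
  -- everywhere by continuity.
  refine ⟨fun y => w y y, fun x hx => ContMDiffAt.contMDiffWithinAt ?_, fun x hx =>
    (hw x hx).2.self_of_nhds⟩
  refine (hw x hx).1.congr_of_eventuallyEq ?_
  filter_upwards [(contMDiffAt_iff_contMDiffAt_nhds (by simp)).1 (hw x hx).1,
    (hw x hx).2.eventually_nhds, hW.mem_nhds hx] with y h1 h2 hy
  refine eq_of_eventually_mul_eq (hw y hy).1.continuousAt h1.continuousAt ?_
    (eventually_ne_zero_of_orderAt_ne_top (hva y hy) (hv' y hy))
  filter_upwards [h2, (hw y hy).2] with z h3 h4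
  rw [h3, h4]

/-- Orders add, and the common order is finite, so it cancels and leaves order zero for the
quotient. -/
theorem ne_zero_of_orderAt_eq {u v w : C → ℂ} {x : C} (hv : ContMDiffAt 𝓘(ℂ) 𝓘(ℂ) ω v x)
    (hw : ContMDiffAt 𝓘(ℂ) 𝓘(ℂ) ω w x) (hv' : orderAt v x ≠ ⊤) (huv : orderAt u x = orderAt v x)
    (h : ∀ᶠ y in 𝓝 x, w y * v y = u y) : w x ≠ 0 := by
  rw [← orderAt_eq_zero_iff hw]
  have h1 := orderAt_mul hw hv
  rw [orderAt_congr (v := u) h, huv] at h1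
  lift orderAt v x to ℕ using hv' with n
  generalize orderAt w x = k at h1 ⊢
  cases k with
  | top => simp at h1
  | coe k => norm_cast at h1 ⊢; omega

end Order


/-! ### The differential of an immersion -/

section Immersion

variable {𝕜 E E' H H' M M' : Type*} [NontriviallyNormedField 𝕜]
  [NormedAddCommGroup E] [NormedSpace 𝕜 E] [NormedAddCommGroup E'] [NormedSpace 𝕜 E']
  [TopologicalSpace H] [TopologicalSpace H'] {I : ModelWithCorners 𝕜 E H}
  {J : ModelWithCorners 𝕜 E' H'} [TopologicalSpace M] [ChartedSpace H M]
  [TopologicalSpace M'] [ChartedSpace H' M'] {n : ℕ∞ω} {f : M → M'} {x : M}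

theorem mfderiv_injective_of_isImmersionAt [I.Boundaryless] [IsManifold I n M] [IsManifold J n M']
    (hn : n ≠ 0) (h : Manifold.IsImmersionAt I J n f x) :
    Function.Injective (mfderiv I J f x) := by
  -- In suitable charts an immersion is `v ↦ (v, 0)`; projecting to the first factor gives a
  -- differentiable local left inverse, and the chain rule then makes the derivative injective.
  let G : M' → M := fun y =>
    (h.domChart.extend I).symm (h.equiv.symm (h.codChart.extend J y)).1
  have hGf : G ∘ f =ᶠ[𝓝 x] id := by
    filter_upwards [h.domChart.open_source.mem_nhds h.mem_domChart_source] with y hy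
    have hy' : y ∈ (h.domChart.extend I).source := by rwa [h.domChart.extend_source]
    have h1 := h.writtenInCharts ((h.domChart.extend I).map_source hy')
    simp only [Function.comp_apply, (h.domChart.extend I).left_inv hy'] at h1
    simp only [G, Function.comp_apply, h1, ContinuousLinearEquiv.symm_apply_apply,
      (h.domChart.extend I).left_inv hy', id]
  have hcod : MDifferentiableAt J 𝓘(𝕜, E') (h.codChart.extend J) (f x) :=
    (h.codChart.contMDiffAt_extend h.codChart_mem_maximalAtlas
      h.mem_codChart_source).mdifferentiableAt hn
  have hlin : MDifferentiableAt 𝓘(𝕜, E') 𝓘(𝕜, E) (fun v => (h.equiv.symm v).1)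
      (h.codChart.extend J (f x)) :=
    (differentiableAt_fst.comp _ h.equiv.symm.differentiableAt).mdifferentiableAt
  have hx' : x ∈ (h.domChart.extend I).source := by
    rw [h.domChart.extend_source]; exact h.mem_domChart_source
  have hval : (h.equiv.symm (h.codChart.extend J (f x))).1 = h.domChart.extend I x := by
    have h1 := h.writtenInCharts ((h.domChart.extend I).map_source hx')
    simp only [Function.comp_apply, (h.domChart.extend I).left_inv hx'] at h1
    rw [h1, ContinuousLinearEquiv.symm_apply_apply]
  have hdom : MDifferentiableAt 𝓘(𝕜, E) I (h.domChart.extend I).symm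
      (h.equiv.symm (h.codChart.extend J (f x))).1 := by
    rw [hval]
    refine ((contMDiffOn_extend_symm h.domChart_mem_maximalAtlas).contMDiffAt ?_).mdifferentiableAt
      hn
    rw [← h.domChart.extend_target']
    exact h.domChart.isOpen_extend_target.mem_nhds ((h.domChart.extend I).map_source hx')
  have hG : MDifferentiableAt J I G (f x) := hdom.comp (f x) (hlin.comp (f x) hcod)
  have h1 := mfderiv_comp x hG (h.contMDiffAt.mdifferentiableAt hn)
  rw [hGf.mfderiv_eq, mfderiv_id] at h1
  intro v w hvw
  have h2 := congrArg (fun l => l v) h1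
  have h3 := congrArg (fun l => l w) h1
  simp only [ContinuousLinearMap.comp_apply, hvw] at h2 h3
  exact h2.trans h3.symm

end Immersion

/-! ### The restriction of the foliation to an invariant curve, in coordinates -/

section CoordField

variable {C : Type*} [TopologicalSpace C] [ChartedSpace ℂ C]

/-- The values of a vector field on a Riemann surface, each read in the preferred chart. -/
def fieldValue (Y : (q : C) → TangentSpace 𝓘(ℂ) q) (q : C) : ℂ := Y q

/-- The derivative of the chart at `p`, read at `y` in the preferred chart of `y`, is the transition
function of the tangent bundle. This turns the chart expression defining `Z` into a cocycle
computation. -/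
theorem vectorFieldInChart_eq_g_mul [IsManifold 𝓘(ℂ) ω C] (Y : (q : C) → TangentSpace 𝓘(ℂ) q) {p y : C}
    (hy : y ∈ (chartAt ℂ p).source) :
    vectorFieldInChart Y p (chartAt ℂ p y) =
      (tangentLineBundle C).g (achart ℂ p) (achart ℂ y) y * fieldValue Y y := by
  have h1 : (extChartAt 𝓘(ℂ) p).symm (chartAt ℂ p y) = y := by
    simpa using (chartAt ℂ p).left_inv hy
  have h2 : (mfderiv 𝓘(ℂ) 𝓘(ℂ) (extChartAt 𝓘(ℂ) p) y : ℂ →L[ℂ] ℂ) =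
      tangentCoordChange 𝓘(ℂ) y p y := by
    rw [← mfderiv_chartAt_eq_tangentCoordChange hy]
    simp only [mfld_simps]
    rfl
  unfold vectorFieldInChart
  rw [h1]
  have h3 := congrArg (fun l : ℂ →L[ℂ] ℂ => l (Y y)) h2
  refine h3.trans ?_
  have h4 := (tangentCoordChange 𝓘(ℂ) y p y).map_smul (fieldValue Y y) (1 : ℂ)
  simp only [smul_eq_mul, mul_one] at h4
  rw [mul_comm]
  exact h4

variable {S : Type*} [TopologicalSpace S] [ChartedSpace Plane S]

theorem Foliation.IsInvariant.mfderiv_restrictVectorField [IsManifold 𝓘(ℂ, Plane) ω S]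
    {ι : Type*} {F : Foliation S ι} {f : C → S} (hC : F.IsInvariant f) {i : ι} {q : C} (hi : f q ∈ F.baseSet i) :
    mfderiv 𝓘(ℂ) 𝓘(ℂ, Plane) f q (restrictVectorField f (F.X i) q) = F.X i (f q) := by
  have h := hC i q hi
  rw [restrictVectorField, dif_pos h]
  exact h.choose_spec

variable [IsManifold 𝓘(ℂ) ω C]

/-- The coefficient, in the chart `a`, of the restriction of `X` to the curve `f`. -/
def coordField (f : C → S) (X : (x : S) → TangentSpace 𝓘(ℂ, Plane) x) (a : atlas ℂ C) (x : C) : ℂ :=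
  (tangentLineBundle C).g a (achart ℂ x) x * fieldValue (restrictVectorField f X) x

theorem coordField_change (f : C → S) (X : (x : S) → TangentSpace 𝓘(ℂ, Plane) x)
    {a b : atlas ℂ C} {x : C} (ha : x ∈ a.1.source) (hb : x ∈ b.1.source) :
    coordField f X a x = (tangentLineBundle C).g a b x * coordField f X b x := by
  rw [coordField, coordField, ← mul_assoc,
    (tangentLineBundle C).g_comp a b (achart ℂ x) x ha hb (mem_chart_source ℂ x)]

theorem orderAt_coordField_achart (f : C → S) (X : (x : S) → TangentSpace 𝓘(ℂ, Plane) x) (p : C) :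
    orderAt (coordField f X (achart ℂ p)) p =
      analyticOrderAt (vectorFieldInChart (restrictVectorField f X) p) (chartAt ℂ p p) := by
  refine analyticOrderAt_congr ?_
  filter_upwards [(chartAt ℂ p).open_target.mem_nhds (mem_chart_target ℂ p)] with v hv
  have h := vectorFieldInChart_eq_g_mul (restrictVectorField f X) ((chartAt ℂ p).map_target hv)
  rw [(chartAt ℂ p).right_inv hv] at h
  exact h.symm

variable [IsManifold 𝓘(ℂ, Plane) ω S] {ι : Type*} {F : Foliation S ι} {f : C → S}

variable (hf : Manifold.IsSmoothEmbedding 𝓘(ℂ) 𝓘(ℂ, Plane) ω f) (hC : F.IsInvariant f)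
include hf

theorem mfderiv_injective_of_isSmoothEmbedding (q : C) :
    Function.Injective (mfderiv 𝓘(ℂ) 𝓘(ℂ, Plane) f q) :=
  mfderiv_injective_of_isImmersionAt (n := ω) (by simp) (hf.isImmersion.isImmersionAt q)

include hC

/-- The restricted field is defined by a choice of preimage under `df`; injectivity of `df` makes
that preimage unique, so relations between the `X i` descend to `C`. -/
theorem restrictVectorField_eq_g_smul {i j : ι} {q : C} (hi : f q ∈ F.baseSet i)
    (hj : f q ∈ F.baseSet j) :
    restrictVectorField f (F.X i) q = F.g i j (f q) • restrictVectorField f (F.X j) q := by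
  refine mfderiv_injective_of_isSmoothEmbedding hf q ?_
  rw [map_smul, hC.mfderiv_restrictVectorField hi, hC.mfderiv_restrictVectorField hj,
    F.X_eq i j _ hi hj]

theorem coordField_eq_g_mul {i j : ι} (a : atlas ℂ C) {q : C} (hi : f q ∈ F.baseSet i)
    (hj : f q ∈ F.baseSet j) :
    coordField f (F.X i) a q = F.g i j (f q) * coordField f (F.X j) a q := by
  have h : fieldValue (restrictVectorField f (F.X i)) q =
      F.g i j (f q) * fieldValue (restrictVectorField f (F.X j)) q :=
    restrictVectorField_eq_g_smul hf hC hi hj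
  rw [coordField, h, coordField]
  ring

/-- The chosen preimage is not visibly holomorphic. In a trivialisation of the tangent bundle of `S`
near `f x`, however, the coefficient is the scalar relating two holomorphic vectors, `df(∂/∂z)`
(here `B`) and `X i ∘ f` (here `A`). Since `B x ≠ 0`, it is a quotient of components. -/
theorem contMDiffAt_coordField_achart {i : ι} {x : C} (hi : f x ∈ F.baseSet i) :
    ContMDiffAt 𝓘(ℂ) 𝓘(ℂ) ω (coordField f (F.X i) (achart ℂ x)) x := by
  have hfx : ContMDiffAt 𝓘(ℂ) 𝓘(ℂ, Plane) ω f x := hf.contMDiff x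
  have m1 : IsManifold 𝓘(ℂ) (ω + 1) C := inferInstanceAs (IsManifold 𝓘(ℂ) ω C)
  have m2 : IsManifold 𝓘(ℂ, Plane) (ω + 1) S := inferInstanceAs (IsManifold 𝓘(ℂ, Plane) ω S)
  let D : C → ℂ →L[ℂ] Plane := fun q => mfderiv 𝓘(ℂ) 𝓘(ℂ, Plane) f q
  let V : C → Plane := fun q => F.X i (f q)
  have hDV : ∀ q, f q ∈ F.baseSet i → D q (fieldValue (restrictVectorField f (F.X i)) q) = V q :=
    fun q hq => hC.mfderiv_restrictVectorField hq
  have hDx : D x 1 ≠ 0 := fun h => one_ne_zero (α := ℂ)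
    (mfderiv_injective_of_isSmoothEmbedding hf x (Eq.trans h (map_zero (D x)).symm))
  let A : C → Plane := fun q => tangentCoordChange 𝓘(ℂ, Plane) (f q) (f x) (f q) (V q)
  let B : C → Plane := fun q => inTangentCoordinates 𝓘(ℂ) 𝓘(ℂ, Plane) id f D x q 1
  have hA : ContMDiffAt 𝓘(ℂ) 𝓘(ℂ, Plane) ω A x := by
    have h1 := (F.holomorphic_X i).contMDiffAt ((F.baseSet i).isOpen.mem_nhds hi)
    have h2 := (Bundle.contMDiffAt_section (f x)).1 h1
    exact h2.comp x hfx
  have hB : ContMDiffAt 𝓘(ℂ) 𝓘(ℂ, Plane) ω B x :=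
    (hfx.mfderiv_const (m := ω) le_rfl).clm_apply contMDiffAt_const
  have hBeq : ∀ q, q ∈ (chartAt ℂ x).source → f q ∈ (chartAt Plane (f x)).source →
      B q = tangentCoordChange 𝓘(ℂ, Plane) (f q) (f x) (f q)
        (D q (tangentCoordChange 𝓘(ℂ) x q q 1)) := by
    intro q h1 h2
    simp only [B]
    rw [inTangentCoordinates_eq id f D h1 h2]
    rfl
  have hrel : ∀ᶠ q in 𝓝 x, coordField f (F.X i) (achart ℂ x) q • B q = A q := by
    have hc := hf.isEmbedding.continuous.continuousAt (x := x)
    filter_upwards [(chartAt ℂ x).open_source.mem_nhds (mem_chart_source ℂ x),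
      hc.eventually ((chartAt Plane (f x)).open_source.mem_nhds (mem_chart_source Plane (f x))),
      hc.eventually ((F.baseSet i).isOpen.mem_nhds hi)] with q h1 h2 h3
    -- Multiplying the coefficient by `∂/∂z` recovers the field, as the two transition functions
    -- between the charts at `x` and at `q` are inverse to each other.
    have h4 : coordField f (F.X i) (achart ℂ x) q • (tangentCoordChange 𝓘(ℂ) x q q (1 : ℂ)) =
        fieldValue (restrictVectorField f (F.X i)) q := by
      have h5 := (tangentLineBundle C).g_comp (achart ℂ q) (achart ℂ x) (achart ℂ q) q
        (mem_chart_source ℂ q) h1 (mem_chart_source ℂ q)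
      rw [(tangentLineBundle C).g_self (achart ℂ q) q (mem_chart_source ℂ q)] at h5
      have h6 : tangentCoordChange 𝓘(ℂ) x q q (1 : ℂ) =
        (tangentLineBundle C).g (achart ℂ q) (achart ℂ x) q := rfl
      rw [h6, coordField, smul_eq_mul, mul_right_comm, mul_comm (LineBundle.g _ _ _ _), h5, one_mul]
    rw [hBeq q h1 h2, ← map_smul, ← map_smul, h4, hDV q h3]
  have hB0 : B x ≠ 0 := by
    rwa [hBeq x (mem_chart_source ℂ x) (mem_chart_source Plane (f x)),
      tangentCoordChange_self (mem_extChartAt_source x),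
      tangentCoordChange_self (mem_extChartAt_source (f x))]
  obtain ⟨j, hj⟩ : ∃ j, B x j ≠ 0 := by
    by_contra! h
    exact hB0 (by ext j; simpa using h j)
  have hcoord : ∀ {G : C → Plane}, ContMDiffAt 𝓘(ℂ) 𝓘(ℂ, Plane) ω G x →
      ContMDiffAt 𝓘(ℂ) 𝓘(ℂ) ω (fun q => G q j) x := fun hG =>
    (EuclideanSpace.proj (𝕜 := ℂ) (ι := Fin 2) j : Plane →L[ℂ] ℂ).contMDiff.contMDiffAt.comp x hG
  have hBj := hcoord hB
  refine ((hcoord hA).div₀ hBj hj).congr_of_eventuallyEq ?_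
  filter_upwards [hrel, hBj.continuousAt.eventually_ne hj] with q h1 h2
  have h3 : A q j = coordField f (F.X i) (achart ℂ x) q * B q j := by rw [← h1]; rfl
  rw [Pi.div_apply, h3, mul_div_cancel_right₀ _ h2]

theorem contMDiffAt_coordField {i : ι} {a : atlas ℂ C} {x : C} (hi : f x ∈ F.baseSet i)
    (ha : x ∈ a.1.source) : ContMDiffAt 𝓘(ℂ) 𝓘(ℂ) ω (coordField f (F.X i) a) x := by
  have hx := mem_chart_source ℂ x
  have h1 := ((tangentLineBundle C).holomorphic a (achart ℂ x)).contMDiffAt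
    ((a.1.open_source.inter (chartAt ℂ x).open_source).mem_nhds ⟨ha, hx⟩)
  refine (h1.mul (contMDiffAt_coordField_achart hf hC hi)).congr_of_eventuallyEq ?_
  filter_upwards [a.1.open_source.mem_nhds ha, (chartAt ℂ x).open_source.mem_nhds hx] with y h2 h3
  exact coordField_change f _ h2 h3

/-- Infinite order would make `X i` vanish along a whole piece of the curve through `f p`; as `f` is
injective, this contradicts the isolation of the zeros. -/
theorem orderAt_coordField_achart_ne_top {i : ι} {p : C} (hi : f p ∈ F.baseSet i) :
    orderAt (coordField f (F.X i) (achart ℂ p)) p ≠ ⊤ := by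
  intro h
  rw [orderAt, analyticOrderAt_eq_top] at h
  have h1 := ((chartAt ℂ p).continuousAt (mem_chart_source ℂ p)).eventually h
  have hc := hf.isEmbedding.continuous.continuousAt (x := p)
  have h2 := hc.eventually (eventually_nhdsWithin_iff.1 (F.isolated_zeros i (f p) hi))
  have := nhdsNE_neBot_curve p
  have hev : ∀ᶠ q in 𝓝[≠] p, False := by
    refine eventually_nhdsWithin_iff.2 ?_
    filter_upwards [h1, h2, (chartAt ℂ p).open_source.mem_nhds (mem_chart_source ℂ p),
      hc.eventually ((F.baseSet i).isOpen.mem_nhds hi)] with q h3 h4 h5 h6 hq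
    refine h4 (fun h => hq (hf.isEmbedding.injective h)) ?_
    rw [Function.comp_apply, (chartAt ℂ p).left_inv h5, coordField] at h3
    have h7 : restrictVectorField f (F.X i) q = 0 := (mul_eq_zero.1 h3).resolve_left
      ((tangentLineBundle C).g_ne_zero h5 (mem_chart_source ℂ q))
    rw [← hC.mfderiv_restrictVectorField h6, h7, map_zero]
  exact this.ne (by simpa using hev)

/-- The coefficients of the restriction of the foliation vanish to the order `Z(F, C, p)`. -/
theorem orderAt_coordField {i : ι} {a : atlas ℂ C} {p : C} (hi : f p ∈ F.baseSet i)
    (ha : p ∈ a.1.source) : orderAt (coordField f (F.X i) a) p = F.Z f p := by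
  have hp := mem_chart_source ℂ p
  have hj := (F.exists_mem (f p)).choose_spec
  set j := (F.exists_mem (f p)).choose
  have hZ : orderAt (coordField f (F.X j) (achart ℂ p)) p = F.Z f p := by
    have h := orderAt_coordField_achart_ne_top hf hC hj
    rw [orderAt_coordField_achart] at h ⊢
    exact (Nat.cast_analyticOrderNatAt h).symm
  have hT := ((tangentLineBundle C).holomorphic a (achart ℂ p)).contMDiffAt
    ((a.1.open_source.inter (chartAt ℂ p).open_source).mem_nhds ⟨ha, hp⟩)
  have hc := hf.isEmbedding.continuous.continuousAt (x := p)
  have hg : ContMDiffAt 𝓘(ℂ) 𝓘(ℂ) ω (fun q => F.g i j (f q)) p :=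
    ((F.holomorphic_g i j).contMDiffAt (((F.baseSet i).isOpen.inter
      (F.baseSet j).isOpen).mem_nhds ⟨hi, hj⟩)).comp p (hf.contMDiff p)
  -- `Z` is computed with a chosen generator and the preferred chart; any other pair changes the
  -- coefficient by the unit `g * T`.
  have heq : coordField f (F.X i) a =ᶠ[𝓝 p] fun q =>
      (F.g i j (f q) * (tangentLineBundle C).g a (achart ℂ p) q) *
        coordField f (F.X j) (achart ℂ p) q := by
    filter_upwards [a.1.open_source.mem_nhds ha, (chartAt ℂ p).open_source.mem_nhds hp,
      hc.eventually ((F.baseSet i).isOpen.mem_nhds hi),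
      hc.eventually ((F.baseSet j).isOpen.mem_nhds hj)] with q h1 h2 h3 h4
    rw [coordField_eq_g_mul hf hC a h3 h4, coordField_change f _ h1 (b := achart ℂ p) h2, mul_assoc]
  have hgT : ContMDiffAt 𝓘(ℂ) 𝓘(ℂ) ω
      (fun q => F.g i j (f q) * (tangentLineBundle C).g a (achart ℂ p) q) p := hg.mul hT
  rw [orderAt_congr heq, orderAt_mul hgT (contMDiffAt_coordField_achart hf hC hj), hZ,
    (orderAt_eq_zero_iff hgT).2, zero_add]
  exact mul_ne_zero (F.g_ne_zero i j _ hi hj) ((tangentLineBundle C).g_ne_zero ha hp)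

end CoordField


/-! ### The canonical bundle along an invariant curve -/

section Iso

variable {C : Type*} [TopologicalSpace C] [ChartedSpace ℂ C] [IsManifold 𝓘(ℂ) ω C]

theorem contMDiffOn_localEquation_of_nonneg {D : Function.locallyFinsupp C ℤ} {p : C}
    (hD : 0 ≤ D p) :
    ContMDiffOn 𝓘(ℂ) 𝓘(ℂ) ω (localEquation D p) (chartAt ℂ p).source := by
  obtain ⟨n, hn⟩ := Int.eq_ofNat_of_zero_le hD
  have h : localEquation D p = fun x => (chartAt ℂ p x - chartAt ℂ p p) ^ n := by
    funext x
    rw [localEquation, hn, zpow_natCast]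
  rw [h]
  exact ((contMDiffOn_chart (I := 𝓘(ℂ)) (x := p)).sub contMDiffOn_const).pow n

/-- Only `p` itself can contribute: `divisorNhd` omits the other points of the support, so elsewhere
the order of `D` is zero and the equation does not vanish. -/
theorem orderAt_localEquation [T1Space C] {D : Function.locallyFinsupp C ℤ} {p x : C} {n : ℕ}
    (hD : 0 ≤ D p) (hx : x ∈ divisorNhd D p) (hn : D x = n) :
    orderAt (localEquation D p) x = n := by
  by_cases hxp : x = p
  · subst hxp
    rw [orderAt, ← analyticOrderAt_centeredMonomial (n := n) (z₀ := chartAt ℂ x x)]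
    refine analyticOrderAt_congr ?_
    filter_upwards [(chartAt ℂ x).open_target.mem_nhds (mem_chart_target ℂ x)] with v hv
    simp only [Function.comp_apply, localEquation, (chartAt ℂ x).right_inv hv, hn, zpow_natCast,
      Pi.pow_apply]
  · have h0 : D x = 0 := by
      by_contra h
      exact hx.2 ⟨h, hxp⟩
    have hn0 : n = 0 := by rw [h0] at hn; exact_mod_cast hn.symm
    rw [hn0, Nat.cast_zero, orderAt_eq_zero_iff ((contMDiffOn_localEquation_of_nonneg hD).contMDiffAt
      ((chartAt ℂ p).open_source.mem_nhds hx.1))]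
    refine zpow_ne_zero _ (sub_ne_zero.2 fun h => hxp ?_)
    exact (chartAt ℂ p).injOn hx.1 (mem_chart_source ℂ p) h

variable {S : Type*} [TopologicalSpace S] [ChartedSpace Plane S] [IsManifold 𝓘(ℂ, Plane) ω S]
  {ι : Type*} {F : Foliation S ι} {f : C → S}

theorem exists_localEquation_eq_mul_coordField [T1Space C]
    (hf : Manifold.IsSmoothEmbedding 𝓘(ℂ) 𝓘(ℂ, Plane) ω f) (hC : F.IsInvariant f) (i : ι)
    (a : atlas ℂ C) (p : C) :
    ∃ w : C → ℂ, (ContMDiffOn 𝓘(ℂ) 𝓘(ℂ) ω w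
        ((a.1.source ∩ divisorNhd (F.zeroDivisor f hf hC) p) ∩ f ⁻¹' F.baseSet i)) ∧
      ∀ x ∈ (a.1.source ∩ divisorNhd (F.zeroDivisor f hf hC) p) ∩ f ⁻¹' F.baseSet i,
        w x * coordField f (F.X i) a x = localEquation (F.zeroDivisor f hf hC) p x ∧ w x ≠ 0 := by
  set D := F.zeroDivisor f hf hC
  have hD : ∀ x, D x = (F.Z f x : ℤ) := fun _ => rfl
  have hDp : 0 ≤ D p := by rw [hD]; positivity
  set W : Set C := (a.1.source ∩ divisorNhd D p) ∩ f ⁻¹' F.baseSet i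
  have hW : IsOpen W := (a.1.open_source.inter (divisorNhd D p).isOpen).inter
    ((F.baseSet i).isOpen.preimage hf.isEmbedding.continuous)
  have hu : ContMDiffOn 𝓘(ℂ) 𝓘(ℂ) ω (localEquation D p) W :=
    (contMDiffOn_localEquation_of_nonneg hDp).mono fun x hx => hx.1.2.1
  have hv : ∀ x ∈ W, ContMDiffAt 𝓘(ℂ) 𝓘(ℂ) ω (coordField f (F.X i) a) x := fun x hx =>
    contMDiffAt_coordField hf hC hx.2 hx.1.1
  have hvo : ∀ x ∈ W, orderAt (coordField f (F.X i) a) x = F.Z f x := fun x hx =>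
    orderAt_coordField hf hC hx.2 hx.1.1
  have huo : ∀ x ∈ W, orderAt (localEquation D p) x = F.Z f x := fun x hx =>
    orderAt_localEquation hDp hx.1.2 (hD x)
  obtain ⟨w, hw, hwv⟩ := exists_quotient hW hu (fun x hx => (hv x hx).contMDiffWithinAt)
    (fun x hx => by simp [hvo x hx]) (fun x hx => by rw [hvo x hx, huo x hx])
  refine ⟨w, hw, fun x hx => ⟨hwv x hx, ?_⟩⟩
  refine ne_zero_of_orderAt_eq (u := localEquation D p) (hv x hx) (hw.contMDiffAt (hW.mem_nhds hx))
    (by simp [hvo x hx]) (by rw [hvo x hx, huo x hx]) ?_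
  filter_upwards [hW.mem_nhds hx] with y hy using hwv y hy

theorem nonempty_iso_cotangent_tensor_divisor [T1Space C]
    (hf : Manifold.IsSmoothEmbedding 𝓘(ℂ) 𝓘(ℂ, Plane) ω f) (hC : F.IsInvariant f) :
    Nonempty ((F.canonicalBundle.pullback f hf.contMDiff).Iso
      ((cotangentLineBundle C).tensor (divisorLineBundle (F.zeroDivisor f hf hC)))) := by
  choose w hw hw' using exists_localEquation_eq_mul_coordField hf hC
  set D := F.zeroDivisor f hf hC
  refine ⟨⟨fun c i => w i c.1 c.2, fun c i => hw i c.1 c.2,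
    fun c i x hc hi => (hw' i c.1 c.2 x ⟨hc, hi⟩).2, ?_⟩⟩
  rintro ⟨a, p⟩ ⟨b, q⟩ i j x hap hbq hi hj
  set L := F.canonicalBundle.pullback f hf.contMDiff
  set L' := (cotangentLineBundle C).tensor (divisorLineBundle D)
  have hWi : ∀ c k, x ∈ L'.baseSet c → x ∈ L.baseSet k →
      (L'.baseSet c ∩ L.baseSet k : Set C) ∈ 𝓝 x := fun c k hc hk =>
    ((L'.baseSet c).isOpen.inter (L.baseSet k).isOpen).mem_nhds ⟨hc, hk⟩
  have hcont : ∀ c k, x ∈ L'.baseSet c → x ∈ L.baseSet k → ContinuousAt (w k c.1 c.2) x :=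
    fun c k hc hk => ((hw k c.1 c.2).contMDiffAt (hWi c k hc hk)).continuousAt
  have hg : ContinuousAt (L.g i j) x := ((L.holomorphic i j).contMDiffAt
    (((L.baseSet i).isOpen.inter (L.baseSet j).isOpen).mem_nhds ⟨hi, hj⟩)).continuousAt
  have hg' : ContinuousAt (L'.g (a, p) (b, q)) x := ((L'.holomorphic (a, p) (b, q)).contMDiffAt
    (((L'.baseSet _).isOpen.inter (L'.baseSet _).isOpen).mem_nhds ⟨hap, hbq⟩)).continuousAt
  -- After multiplication by `v j b`, both sides become the inverse of `T a b` times the local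
  -- equation at `p`; continuity removes the factor at its isolated zeros.
  refine eq_of_eventually_mul_eq (v := coordField f (F.X j) b)
    ((hcont (a, p) i hap hi).mul hg) (hg'.mul (hcont (b, q) j hbq hj)) ?_
    (eventually_ne_zero_of_orderAt_ne_top (contMDiffAt_coordField hf hC hj hbq.1)
      (by simp [orderAt_coordField hf hC hj hbq.1]))
  filter_upwards [hWi _ _ hap hi, hWi _ _ hbq hj] with y h1 h2
  have e1 := (hw' i a p y h1).1
  have e2 := (hw' j b q y h2).1
  simp only [Pi.mul_apply]
  rw [mul_assoc, mul_assoc, e2]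
  have e3 := coordField_eq_g_mul hf hC a h1.2 h2.2
  have e4 := coordField_change f (F.X j) h1.1.1 h2.1.1
  have hT : (tangentLineBundle C).g a b y ≠ 0 := (tangentLineBundle C).g_ne_zero h1.1.1 h2.1.1
  have hLg : L.g i j y = F.g i j (f y) := rfl
  have hL'g : L'.g (a, p) (b, q) y =
    ((tangentLineBundle C).g a b y)⁻¹ * (divisorLineBundle D).g p q y := rfl
  have hdiv : (divisorLineBundle D).g p q y * localEquation D q y = localEquation D p y := by
    by_cases hpq : p = q
    · subst hpq
      rw [(divisorLineBundle D).g_self p y h1.1.2, one_mul]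
    · simp only [divisorLineBundle, hpq, if_false]
      exact div_mul_cancel₀ _ (localEquation_ne_zero D (Ne.symm hpq) h2.1.2 h1.1.2)
  rw [hL'g, mul_assoc, hdiv, hLg, ← e1, e3, e4]
  field_simp

end Iso


/-! ### Sections of the powers of the canonical bundle along an invariant curve -/

/-- Rank-nullity for `J`: its kernel is no larger than `W`, and its range lies in a space of
dimension `Fintype.card κ`. -/
theorem toENat_rank_le_add_card {V W κ : Type*} [AddCommGroup V] [Module ℂ V] [AddCommGroup W]
    [Module ℂ W] [Fintype κ] (J : V →ₗ[ℂ] κ → ℂ) (Φ : W →ₗ[ℂ] V)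
    (h : LinearMap.ker J ≤ LinearMap.range Φ) :
    Cardinal.toENat (Module.rank ℂ V) ≤ Cardinal.toENat (Module.rank ℂ W) + Fintype.card κ := by
  have h1 : Cardinal.toENat (Module.rank ℂ (LinearMap.ker J)) ≤
      Cardinal.toENat (Module.rank ℂ W) := by
    have h2 := OrderHomClass.mono Cardinal.toENat (Submodule.rank_mono h)
    have h3 := OrderHomClass.mono Cardinal.toENat (lift_rank_range_le Φ)
    rw [Cardinal.toENat_lift, Cardinal.toENat_lift] at h3
    exact h2.trans h3
  have h4 : Cardinal.toENat (Module.rank ℂ (LinearMap.range J)) ≤ Fintype.card κ := by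
    rw [← Module.finrank_eq_rank ℂ (LinearMap.range J), Cardinal.toENat_nat,
      ← Module.finrank_fintype_fun_eq_card ℂ (η := κ)]
    exact_mod_cast Submodule.finrank_le (LinearMap.range J)
  have h5 := congrArg Cardinal.toENat (LinearMap.lift_rank_range_add_rank_ker J)
  rw [map_add, Cardinal.toENat_lift, Cardinal.toENat_lift, Cardinal.toENat_lift] at h5
  rw [← h5, add_comm]
  exact add_le_add h1 h4

section Sections

variable {C : Type*} [TopologicalSpace C] [ChartedSpace ℂ C]

namespace LineBundle

variable {ι : Type*} (L : LineBundle ℂ C ι)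

theorem contMDiffAt_of_mem_sections {s : ι → C → ℂ} (hs : s ∈ L.sections) {i : ι} {x : C}
    (hx : x ∈ L.baseSet i) : ContMDiffAt 𝓘(ℂ) 𝓘(ℂ) ω (s i) x :=
  (hs.1 i).contMDiffAt ((L.baseSet i).isOpen.mem_nhds hx)

variable [IsManifold 𝓘(ℂ) ω C]

/-- Frames differ by units, so vanishing conditions at a point need only be imposed in one frame. -/
theorem orderAt_section_eq {s : ι → C → ℂ} (hs : s ∈ L.sections) {i j : ι} {x : C}
    (hi : x ∈ L.baseSet i) (hj : x ∈ L.baseSet j) : orderAt (s i) x = orderAt (s j) x := by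
  have hg := (L.holomorphic i j).contMDiffAt
    (((L.baseSet i).isOpen.inter (L.baseSet j).isOpen).mem_nhds ⟨hi, hj⟩)
  have h : s i =ᶠ[𝓝 x] fun y => L.g i j y * s j y := by
    filter_upwards [(L.baseSet i).isOpen.mem_nhds hi, (L.baseSet j).isOpen.mem_nhds hj] with y h1 h2
    exact hs.2.2 i j y h1 h2
  rw [orderAt_congr h, orderAt_mul hg (L.contMDiffAt_of_mem_sections hs hj),
    (orderAt_eq_zero_iff hg).2 (L.g_ne_zero hi hj), zero_add]

/-- The derivatives of order less than `n p` at the points `p` of `P` of a section, read in the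
frame `c p` and in the preferred chart at `p`. -/
def jets (c : C → ι) (hc : ∀ p, p ∈ L.baseSet (c p)) (P : Finset C) (n : C → ℕ) :
    L.sections →ₗ[ℂ] (Σ p : P, Fin (n p)) → ℂ where
  toFun s e := iteratedDeriv e.2 (s.1 (c e.1) ∘ (chartAt ℂ e.1.1).symm) (chartAt ℂ e.1.1 e.1.1)
  map_add' s t := by
    funext e
    have hs := analyticAt_comp_symm_of_contMDiffAt (L.contMDiffAt_of_mem_sections s.2 (hc e.1))
    have ht := analyticAt_comp_symm_of_contMDiffAt (L.contMDiffAt_of_mem_sections t.2 (hc e.1))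
    exact iteratedDeriv_add hs.contDiffAt ht.contDiffAt
  map_smul' r s := by
    funext e
    exact iteratedDeriv_const_smul_field r _

theorem le_orderAt_of_jets_eq_zero {c : C → ι} {hc : ∀ p, p ∈ L.baseSet (c p)} {P : Finset C}
    {n : C → ℕ} {s : L.sections} (hs : L.jets c hc P n s = 0) {p : C} (hp : p ∈ P) {i : ι}
    (hi : p ∈ L.baseSet i) : (n p : ℕ∞) ≤ orderAt (s.1 i) p := by
  rw [L.orderAt_section_eq s.2 hi (hc p), orderAt,
    natCast_le_analyticOrderAt_iff_iteratedDeriv_eq_zero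
      (analyticAt_comp_symm_of_contMDiffAt (L.contMDiffAt_of_mem_sections s.2 (hc p)))]
  intro k hk
  exact congrFun hs ⟨⟨p, hp⟩, ⟨k, hk⟩⟩

end LineBundle

variable [IsManifold 𝓘(ℂ) ω C] {S : Type*} [TopologicalSpace S] [ChartedSpace Plane S]

theorem section_mul_coordField_pow {f : C → S} {m : ℕ} {t : atlas ℂ C → C → ℂ}
    (ht : t ∈ ((cotangentLineBundle C).tensorPow m).sections)
    (X : (x : S) → TangentSpace 𝓘(ℂ, Plane) x) {a b : atlas ℂ C} {x : C} (ha : x ∈ a.1.source)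
    (hb : x ∈ b.1.source) :
    t a x * coordField f X a x ^ m = t b x * coordField f X b x ^ m := by
  have h1 : t a x = ((tangentLineBundle C).g a b x)⁻¹ ^ m * t b x := ht.2.2 a b x ha hb
  have hT := (tangentLineBundle C).g_ne_zero (i := a) (j := b) ha hb
  rw [h1, coordField_change f X ha hb, mul_pow, inv_pow]
  field_simp

variable [IsManifold 𝓘(ℂ, Plane) ω S] {ι : Type*} {F : Foliation S ι} {f : C → S}

open Classical in
/-- The map `(Ω¹_C)^{⊗ m} → (K_F|_C)^{⊗ m}` on sections: contraction of forms with the restriction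
of the foliation. -/
def contractRestriction (hf : Manifold.IsSmoothEmbedding 𝓘(ℂ) 𝓘(ℂ, Plane) ω f)
    (hC : F.IsInvariant f) (m : ℕ) :
    ((cotangentLineBundle C).tensorPow m).sections →ₗ[ℂ]
      ((F.canonicalBundle.pullback f hf.contMDiff).tensorPow m).sections where
  toFun t := ⟨fun i x => if f x ∈ F.baseSet i then
      t.1 (achart ℂ x) x * coordField f (F.X i) (achart ℂ x) x ^ m else 0, by
    refine ⟨fun i x hx => ContMDiffAt.contMDiffWithinAt ?_, fun i x hx => if_neg hx,
      fun i j x hi hj => ?_⟩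
    · have h1 := LineBundle.contMDiffAt_of_mem_sections _ t.2 (i := achart ℂ x)
        (mem_chart_source ℂ x)
      -- The formula uses the chart preferred at the moving point; the contraction is independent of
      -- the chart, so near `x` the chart at `x` may be kept fixed.
      refine (h1.mul ((contMDiffAt_coordField_achart hf hC hx).pow m)).congr_of_eventuallyEq ?_
      filter_upwards [(chartAt ℂ x).open_source.mem_nhds (mem_chart_source ℂ x),
        (((F.canonicalBundle.pullback f hf.contMDiff).tensorPow m).baseSet i).isOpen.mem_nhds hx]
        with y h2 h3
      exact (if_pos h3).trans (section_mul_coordField_pow t.2 _ (mem_chart_source ℂ y) h2)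
    · have h1 : f x ∈ F.baseSet i := hi
      have h2 : f x ∈ F.baseSet j := hj
      have h3 : ((F.canonicalBundle.pullback f hf.contMDiff).tensorPow m).g i j x =
        F.g i j (f x) ^ m := rfl
      simp only [h1, h2, if_true]
      rw [h3, coordField_eq_g_mul hf hC _ h1 h2]
      ring⟩
  map_add' t t' := by
    ext i x
    by_cases h : f x ∈ F.baseSet i
    · simp [h, add_mul]
    · simp [h]
  map_smul' r t := by
    ext i x
    by_cases h : f x ∈ F.baseSet i
    · simp [h, mul_assoc]
    · simp [h]

/-- The preimage is `s i / v i a ^ m`, holomorphic by comparison of orders. The factors `g ^ m`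
cancel, so it does not depend on `i`, while the powers of `T` left over are the cocycle of the
`m`-th power of `Ω¹_C`. -/
theorem mem_range_contractRestriction (hf : Manifold.IsSmoothEmbedding 𝓘(ℂ) 𝓘(ℂ, Plane) ω f)
    (hC : F.IsInvariant f) (m : ℕ)
    (s : ((F.canonicalBundle.pullback f hf.contMDiff).tensorPow m).sections)
    (hs : ∀ i x, f x ∈ F.baseSet i → ((m * F.Z f x : ℕ) : ℕ∞) ≤ orderAt (s.1 i) x) :
    s ∈ LinearMap.range (contractRestriction hf hC m) := by
  classical
  have hWo : ∀ i (a : atlas ℂ C), IsOpen (a.1.source ∩ f ⁻¹' F.baseSet i) := fun i a =>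
    a.1.open_source.inter ((F.baseSet i).isOpen.preimage hf.isEmbedding.continuous)
  have hv : ∀ i (a : atlas ℂ C), ∀ x ∈ a.1.source ∩ f ⁻¹' F.baseSet i,
      ContMDiffAt 𝓘(ℂ) 𝓘(ℂ) ω (fun y => coordField f (F.X i) a y ^ m) x := fun i a x hx =>
    (contMDiffAt_coordField hf hC hx.2 hx.1).pow m
  have hvo : ∀ i (a : atlas ℂ C), ∀ x ∈ a.1.source ∩ f ⁻¹' F.baseSet i,
      orderAt (fun y => coordField f (F.X i) a y ^ m) x = ((m * F.Z f x : ℕ) : ℕ∞) := by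
    intro i a x hx
    rw [orderAt_pow (contMDiffAt_coordField hf hC hx.2 hx.1), orderAt_coordField hf hC hx.2 hx.1]
    simp
  have hvne : ∀ i (a : atlas ℂ C), ∀ x ∈ a.1.source ∩ f ⁻¹' F.baseSet i,
      ∀ᶠ y in 𝓝[≠] x, coordField f (F.X i) a y ^ m ≠ 0 := fun i a x hx =>
    eventually_ne_zero_of_orderAt_ne_top (hv i a x hx)
      (by rw [hvo i a x hx]; exact ENat.natCast_ne_top _)
  have hex : ∀ i (a : atlas ℂ C), ∃ w : C → ℂ,
      ContMDiffOn 𝓘(ℂ) 𝓘(ℂ) ω w (a.1.source ∩ f ⁻¹' F.baseSet i) ∧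
      ∀ x ∈ a.1.source ∩ f ⁻¹' F.baseSet i, w x * coordField f (F.X i) a x ^ m = s.1 i x :=
    fun i a => exists_quotient (hWo i a) ((s.2.1 i).mono fun x hx => hx.2)
      (fun x hx => (hv i a x hx).contMDiffWithinAt)
      (fun x hx => by rw [hvo i a x hx]; exact ENat.natCast_ne_top _)
      (fun x hx => by rw [hvo i a x hx]; exact hs i x hx.2)
  choose w hw hwv using hex
  have hwc : ∀ i (a : atlas ℂ C), ∀ x ∈ a.1.source ∩ f ⁻¹' F.baseSet i, ContinuousAt (w i a) x :=
    fun i a x hx => ((hw i a).contMDiffAt ((hWo i a).mem_nhds hx)).continuousAt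
  choose c hc using fun x => F.exists_mem (f x)
  have hindep : ∀ i j (a : atlas ℂ C) x, x ∈ a.1.source → f x ∈ F.baseSet i →
      f x ∈ F.baseSet j → w i a x = w j a x := by
    intro i j a x ha hi hj
    refine eq_of_eventually_mul_eq (hwc i a x ⟨ha, hi⟩) (hwc j a x ⟨ha, hj⟩) ?_
      (hvne i a x ⟨ha, hi⟩)
    filter_upwards [(hWo i a).mem_nhds ⟨ha, hi⟩, (hWo j a).mem_nhds ⟨ha, hj⟩] with y h1 h2
    have h3 : s.1 i y = F.g i j (f y) ^ m * s.1 j y := s.2.2.2 i j y h1.2 h2.2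
    rw [hwv i a y h1, h3, ← hwv j a y h2, coordField_eq_g_mul hf hC a h1.2 h2.2]
    ring
  have hchange : ∀ i (a b : atlas ℂ C) x, x ∈ a.1.source → x ∈ b.1.source → f x ∈ F.baseSet i →
      w i a x = ((cotangentLineBundle C).tensorPow m).g a b x * w i b x := by
    intro i a b x ha hb hi
    have hg := (((cotangentLineBundle C).tensorPow m).holomorphic a b).contMDiffAt
      ((a.1.open_source.inter b.1.open_source).mem_nhds ⟨ha, hb⟩)
    refine eq_of_eventually_mul_eq (hwc i a x ⟨ha, hi⟩)
      (hg.continuousAt.mul (hwc i b x ⟨hb, hi⟩)) ?_ (hvne i a x ⟨ha, hi⟩)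
    filter_upwards [(hWo i a).mem_nhds ⟨ha, hi⟩, (hWo i b).mem_nhds ⟨hb, hi⟩] with y h1 h2
    have hT := (tangentLineBundle C).g_ne_zero (i := a) (j := b) h1.1 h2.1
    have hgy : ((cotangentLineBundle C).tensorPow m).g a b y =
      ((tangentLineBundle C).g a b y)⁻¹ ^ m := rfl
    rw [hwv i a y h1, Pi.mul_apply, hgy, ← hwv i b y h2, coordField_change f _ h1.1 h2.1, mul_pow,
      inv_pow]
    field_simp
  -- The index `c x` may jump with `x`; independence of the generator makes this harmless.
  refine ⟨⟨fun a x => if x ∈ a.1.source then w (c x) a x else 0, fun a x hx =>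
    ContMDiffAt.contMDiffWithinAt ?_, fun a x hx => if_neg hx, fun a b x ha hb => ?_⟩, ?_⟩
  · have hxW : x ∈ a.1.source ∩ f ⁻¹' F.baseSet (c x) := ⟨hx, hc x⟩
    refine ((hw (c x) a).contMDiffAt ((hWo (c x) a).mem_nhds hxW)).congr_of_eventuallyEq ?_
    filter_upwards [(hWo (c x) a).mem_nhds hxW] with y hy
    exact (if_pos hy.1).trans (hindep _ _ a y hy.1 (hc y) hy.2)
  · have h1 : x ∈ a.1.source := ha
    have h2 : x ∈ b.1.source := hb
    simp only [h1, h2, if_true]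
    exact hchange (c x) a b x h1 h2 (hc x)
  · ext i x
    by_cases hi : f x ∈ F.baseSet i
    · have hx := mem_chart_source ℂ x
      refine (if_pos hi).trans ?_
      simp only [coe_achart, hx, if_true]
      rw [hindep (c x) i (achart ℂ x) x hx (hc x) hi]
      exact hwv i (achart ℂ x) x ⟨hx, hi⟩
    · exact (if_neg hi).trans (s.2.2.1 i x hi).symm

theorem h0_canonicalBundle_pow_le [T2Space C] [CompactSpace C]
    (hf : Manifold.IsSmoothEmbedding 𝓘(ℂ) 𝓘(ℂ, Plane) ω f) (hC : F.IsInvariant f) (m : ℕ) :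
    ((F.canonicalBundle.pullback f hf.contMDiff).tensorPow m).h0 ≤
      ((cotangentLineBundle C).tensorPow m).h0 + ((m * ∑ᶠ p : C, F.Z f p : ℕ) : ℕ∞) := by
  -- Compactness of `C` makes the locally finite divisor finite, so finitely many jets suffice and
  -- the `finsum` is a genuine sum rather than its default value `0`.
  have hfin : (Function.support (F.Z f)).Finite := by
    refine ((F.zeroDivisor f hf hC).finiteSupport isCompact_univ).subset fun p hp => ?_
    have : (F.Z f p : ℤ) ≠ 0 := by exact_mod_cast hp
    exact this
  choose c hc using fun x => F.exists_mem (f x)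
  set L := (F.canonicalBundle.pullback f hf.contMDiff).tensorPow m
  have h := toENat_rank_le_add_card (L.jets c hc hfin.toFinset fun p => m * F.Z f p)
    (contractRestriction hf hC m) ?_
  · have hcard : Fintype.card (Σ p : hfin.toFinset, Fin (m * F.Z f p)) =
        m * ∑ᶠ p : C, F.Z f p := by
      rw [Fintype.card_sigma, finsum_eq_sum_of_support_subset _ (s := hfin.toFinset) (by simp),
        Finset.mul_sum, ← Finset.sum_coe_sort hfin.toFinset]
      simp
    rw [hcard] at h
    exact h
  · intro s hs
    refine mem_range_contractRestriction hf hC m s fun i x hi => ?_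
    by_cases hx : x ∈ hfin.toFinset
    · exact L.le_orderAt_of_jets_eq_zero hs hx hi
    · have : F.Z f x = 0 := by simpa using hx
      simp [this]

end Sections

end FoliatedSurface

theorem mainTheorem6
    {S : Type*} [TopologicalSpace S] [T2Space S]
    [ChartedSpace FoliatedSurface.Plane S] [IsManifold 𝓘(ℂ, FoliatedSurface.Plane) ω S]
    {ι : Type*} (F : FoliatedSurface.Foliation S ι) (hF : F.IsReduced)
    {C : Type*} [TopologicalSpace C] [T2Space C] [CompactSpace C]
    [ChartedSpace ℂ C] [IsManifold 𝓘(ℂ) ω C]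
    (f : C → S) (hf : Manifold.IsSmoothEmbedding 𝓘(ℂ) 𝓘(ℂ, FoliatedSurface.Plane) ω f)
    (hC : F.IsInvariant f) :
    Nonempty ((F.canonicalBundle.pullback f hf.contMDiff).Iso
      ((FoliatedSurface.cotangentLineBundle C).tensor
        (FoliatedSurface.divisorLineBundle (F.zeroDivisor f hf hC)))) ∧
    ∀ m : ℕ,
      ((F.canonicalBundle.pullback f hf.contMDiff).tensorPow m).h0 ≤
        ((FoliatedSurface.cotangentLineBundle C).tensorPow m).h0 +
          ((m * ∑ᶠ p : C, F.Z f p : ℕ) : ℕ∞) :=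
  ⟨FoliatedSurface.nonempty_iso_cotangent_tensor_divisor hf hC,
    fun m => FoliatedSurface.h0_canonicalBundle_pow_le hf hC m⟩
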